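/- Let $\mathbb X,\mathbb Y$ be finite-dimensional real inner product spaces, $\varphi\colon\mathbb X\to\mathbb R$ locally Lipschitz continuous, $\Phi\colon\mathbb X\rightrightarrows\mathbb Y$ a set-valued mapping with closed graph $\operatorname{gph}\Phi$, $\bar y\in\mathbb Y$, and $\Phi^{-1}(\bar y)=\{x\mid \bar y\in\Phi(x)\}$. Let $\mathbb S_{\mathbb X}$ be the unit sphere of $\mathbb X$; $t_k\searrow0$ means $t_k>0$, $t_k\to0$. **Notation.** For a closed set $Q$ and $z\in Q$, the tangent cone $\mathcal T_Q(z)$ is the set of all $d$ for which there are $d_k\to d$, $t_k\searrow 0$ with $z+t_kd_k\in Q$; $\widehat{\mathcal N}_Q(z)$ is the set of all $\eta$ with $\langle\eta,z'-z\rangle\le o(\|z'-z\|)$ for $z'\in Q$, $z'\to z$; and $\mathcal N_Q(z)$ is the set of all limits of $\eta_k\in\widehat{\mathcal N}_Q(z_k)$ with $z_k\in Q$, $z_k\to z$. All three are empty for $z\notin Q$. With $\operatorname{epi}\varphi=\{(x,\alpha)\in\mathbb X\times\mathbb R\mid\varphi(x)\le\alpha\}$, let $\widehat\partial\varphi(x)$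 (respectively $\partial\varphi(x)$) be the set of all $\eta$ such that $(\eta,-1)$ lies in $\widehat{\mathcal N}_{\operatorname{epi}\varphi}(x,\varphi(x))$ (respectively $\mathcal N_{\operatorname{epi}\varphi}(x,\varphi(x))$). Let $\widehat D^*\Phi(x,y)(y^*)$ (respectively $D^*\Phi(x,y)(y^*)$) be the set of all $x^*$ such that $(x^*,-y^*)$ lies in $\widehat{\mathcal N}_{\operatorname{gph}\Phi}(x,y)$ (respectively $\mathcal N_{\operatorname{gph}\Phi}(x,y)$), and let $\ker D\Phi(\bar x,\bar y)=\{u\mid (u,0)\in\mathcal T_{\operatorname{gph}\Phi}(\bar x,\bar y)\}$. For $\gamma\ge1$, $u\in\mathbb S_{\mathbb X}$ and $v\in\mathbb Y$, the pseudo-coderivative $D^*_\gamma\Phi((\bar x,\bar y);(u,v))(y^*)$ is the set of all $x^*$ for which there are $u_k\to u$, $v_k\to v$, $t_k\searrow0$, $x_k^*\to x^*$, $y_k^*\to y^*$ with $$\Big(x_k^*,-\frac{y_k^*}{(t_k\|u_k\|)^{\gamma-1}}\Big)\in\widehat{\mathcal N}_{\operatorname{gph}\Phi}\big(\bar x+t_ku_k,\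 \bar y+(t_k\|u_k\|)^\gamma v_k\big)\quad\text{for all }k.$$ Gfrerer's pseudo-coderivative $\widetilde D^*_\gamma\Phi((\bar x,\bar y);(u,v))(y^*)$ is defined in the same way, with $\bar y+t_kv_k$ in place of $\bar y+(t_k\|u_k\|)^\gamma v_k$. A direction $u\in\mathbb S_{\mathbb X}$ is *critical* at $\bar x$ if there are $u_k\to u$, $v_k\to0$, $t_k\searrow0$ with $(\bar x+t_ku_k,\bar y+t_kv_k)\in\operatorname{gph}\Phi$ for all $k$ and $\limsup_{k\to\infty}(\varphi(\bar x+t_ku_k)-\varphi(\bar x))/t_k\le0$. $\Phi$ is *metrically pseudo-subregular of order $\gamma$ in direction $u$* at $(\bar x,\bar y)$ if there are $\varepsilon,\delta,\kappa>0$ such that $$\|x-\bar x\|^{\gamma-1}\operatorname{dist}(x,\Phi^{-1}(\bar y))\le\kappa\operatorname{dist}(\bar y,\Phi(x))$$ for all $x$ such that $w=x-\bar x$ satisfies $\|w\|\le\varepsilon$ and $\big\|\|w\|u-\|u\|w\big\|\le\delta\|u\|\|w\|$, where $\operatorname{dist}(\cdot,\varnothing)=\infty$. **Theorem.** Let $\bar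 x$ be a local minimizer of $\min\{\varphi(x)\mid\bar y\in\Phi(x)\}$ (in particular, $\bar y\in\Phi(\bar x)$) and let $\gamma\ge1$. Then at least one of the following holds. (i) $\bar x$ is M-stationary: there is $\lambda\in\mathbb Y$ with $0\in\partial\varphi(\bar x)+D^*\Phi(\bar x,\bar y)(\lambda)$. (ii) There is a critical direction $u\in\mathbb S_{\mathbb X}$ at $\bar x$ with $0\in\partial\varphi(\bar x)+\widetilde D^*_\gamma\Phi((\bar x,\bar y);(u,0))(0)$. (iii) There are a critical direction $u\in\mathbb S_{\mathbb X}$ at $\bar x$, some $v\in\mathbb Y$ and some $\lambda\in\mathbb Y\setminus\{0\}$ with $\langle\lambda,v\rangle\ge0$ and $0\in\partial\varphi(\bar x)+D^*_\gamma\Phi((\bar x,\bar y);(u,v))(\lambda)$. (iv) There are a critical direction $u\in\mathbb S_{\mathbb X}$ at $\bar x$, sequences $x_k,x_k',\eta_k\in\mathbb X$ and $y_k,y_k^*\in\mathbb Y$, and $y^*\in\mathbb Y$ such that $x_k,x_k'\notin\Phi^{-1}(\bar y)$, $y_k\ne\bar y$ and $y_k^*\ne0$ for all $k$ and, with $$v_k^\gamma:=\frac{y_k-\bar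 y}{\|x_k-\bar x\|^\gamma},\qquad\lambda_k^\gamma:=\frac{\|x_k-\bar x\|^\gamma}{\|y_k-\bar y\|}\,y_k^*,$$ one has $x_k\to\bar x$, $x_k'\to\bar x$, $y_k\to\bar y$, $\frac{x_k-\bar x}{\|x_k-\bar x\|}\to u$, $\frac{x_k'-\bar x}{\|x_k'-\bar x\|}\to u$, $v_k^\gamma\to0$, $y_k^*\to y^*$, $\|\lambda_k^\gamma\|\to\infty$, $\eta_k\to0$, $\frac{y_k-\bar y}{\|y_k-\bar y\|}-\frac{\lambda_k^\gamma}{\|\lambda_k^\gamma\|}\to0$, and $$\eta_k\in\widehat\partial\varphi(x_k')+\widehat D^*\Phi(x_k,y_k)\Big(\frac{\lambda_k^\gamma}{\|x_k-\bar x\|^{\gamma-1}}\Big)\quad\text{for all }k.$$ Moreover, if $\Phi$ is metrically pseudo-subregular of order $\gamma$ at $(\bar x,\bar y)$ in every direction $u\in\ker D\Phi(\bar x,\bar y)\cap\mathbb S_{\mathbb X}$, then at least one of (i), (ii), (iii) holds. -/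

import Mathlib

open Filter
open scoped Topology Pointwise

namespace VarAnalysis

section Cones

variable {E : Type*} [NormedAddCommGroup E] [InnerProductSpace ℝ E]

/-- A sequence of positive reals converging to zero, `t k ↘ 0`. -/
def PosNull (t : ℕ → ℝ) : Prop :=
  (∀ k, 0 < t k) ∧ Tendsto t atTop (𝓝 0)

/-- The (Bouligand) tangent cone to `Q` at `x`, empty if `x ∉ Q`. -/
def tangentCone (Q : Set E) (x : E) : Set E :=
  {d | x ∈ Q ∧ ∃ (dk : ℕ → E) (t : ℕ → ℝ), Tendsto dk atTop (𝓝 d) ∧ PosNull t ∧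
    ∀ k, x + t k • dk k ∈ Q}

/-- The regular (Fréchet) normal cone to `Q` at `x`, i.e. all `η` such that
`⟪η, x' - x⟫ ≤ o(‖x' - x‖)` for `x' ∈ Q`, `x' → x`; empty if `x ∉ Q`. -/
def regularNormalCone (Q : Set E) (x : E) : Set E :=
  {η | x ∈ Q ∧ ∀ ε : ℝ, 0 < ε → ∀ᶠ x' in 𝓝[Q] x, inner ℝ η (x' - x) ≤ ε * ‖x' - x‖}

/-- The limiting (Mordukhovich) normal cone to `Q` at `x`; empty if `x ∉ Q`. -/
def limitingNormalCone (Q : Set E) (x : E) : Set E :=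
  {η | x ∈ Q ∧ ∃ xk ηk : ℕ → E, (∀ k, xk k ∈ Q) ∧
    Tendsto xk atTop (𝓝 x) ∧ Tendsto ηk atTop (𝓝 η) ∧
    ∀ k, ηk k ∈ regularNormalCone Q (xk k)}

end Cones

section Maps

variable {X Y : Type*} [NormedAddCommGroup X] [InnerProductSpace ℝ X]
  [NormedAddCommGroup Y] [InnerProductSpace ℝ Y]

/-- The pair `(x, y)` as a point of the product `X × Y` with its Euclidean structure. -/
abbrev pair (x : X) (y : Y) : WithLp 2 (X × Y) := WithLp.toLp 2 (x, y)

/-- The epigraph of `φ`, in the Euclidean product `X × ℝ`. -/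
def epi (φ : X → ℝ) : Set (WithLp 2 (X × ℝ)) := {p | φ p.fst ≤ p.snd}

/-- The regular (Fréchet) subdifferential of `φ` at `x`. -/
def regularSubdiff (φ : X → ℝ) (x : X) : Set X :=
  {η | pair η (-1 : ℝ) ∈ regularNormalCone (epi φ) (pair x (φ x))}

/-- The limiting (Mordukhovich) subdifferential of `φ` at `x`. -/
def limitingSubdiff (φ : X → ℝ) (x : X) : Set X :=
  {η | pair η (-1 : ℝ) ∈ limitingNormalCone (epi φ) (pair x (φ x))}

/-- The graph of the set-valued mapping `Φ`, in the Euclidean product `X × Y`. -/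
def gph (Φ : X → Set Y) : Set (WithLp 2 (X × Y)) := {p | p.snd ∈ Φ p.fst}

/-- The value `Φ⁻¹(y)` of the inverse mapping. -/
def invMap (Φ : X → Set Y) (y : Y) : Set X := {x | y ∈ Φ x}

/-- The kernel of a set-valued mapping. -/
def kerMap (Φ : X → Set Y) : Set X := {x | 0 ∈ Φ x}

/-- The graphical derivative `DΦ(x, y)`. -/
def graphicalDerivative (Φ : X → Set Y) (x : X) (y : Y) : X → Set Y :=
  fun u => {v | pair u v ∈ tangentCone (gph Φ) (pair x y)}

/-- The regular coderivative of `Φ` at `(x, y)`. -/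
def regularCoderivative (Φ : X → Set Y) (x : X) (y : Y) : Y → Set X :=
  fun ys => {xs | pair xs (-ys) ∈ regularNormalCone (gph Φ) (pair x y)}

/-- The limiting coderivative of `Φ` at `(x, y)`. -/
def limitingCoderivative (Φ : X → Set Y) (x : X) (y : Y) : Y → Set X :=
  fun ys => {xs | pair xs (-ys) ∈ limitingNormalCone (gph Φ) (pair x y)}

/-- The pseudo-coderivative of order `γ` of `Φ` at `(x, y)` in direction `(u, v)`
(used only for `‖u‖ = 1`, where `uk k = 0` occurs for finitely many `k` at most). -/
def pseudoCoderivative (γ : ℝ) (Φ : X → Set Y) (x : X) (y : Y) (u : X) (v : Y) : Y → Set X :=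
  fun ys => {xs | ∃ (uk xsk : ℕ → X) (vk ysk : ℕ → Y) (t : ℕ → ℝ),
    Tendsto uk atTop (𝓝 u) ∧ Tendsto vk atTop (𝓝 v) ∧ PosNull t ∧
    Tendsto xsk atTop (𝓝 xs) ∧ Tendsto ysk atTop (𝓝 ys) ∧
    ∀ k, pair (xsk k) (-(((t k * ‖uk k‖) ^ (γ - 1))⁻¹ • ysk k)) ∈
      regularNormalCone (gph Φ)
        (pair (x + t k • uk k) (y + ((t k * ‖uk k‖) ^ γ) • vk k))}

/-- Gfrerer's pseudo-coderivative of order `γ` of `Φ` at `(x, y)` in direction `(u, v)`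
(used only for `‖u‖ = 1`, where `uk k = 0` occurs for finitely many `k` at most). -/
def gfrererPseudoCoderivative (γ : ℝ) (Φ : X → Set Y) (x : X) (y : Y) (u : X) (v : Y) :
    Y → Set X :=
  fun ys => {xs | ∃ (uk xsk : ℕ → X) (vk ysk : ℕ → Y) (t : ℕ → ℝ),
    Tendsto uk atTop (𝓝 u) ∧ Tendsto vk atTop (𝓝 v) ∧ PosNull t ∧
    Tendsto xsk atTop (𝓝 xs) ∧ Tendsto ysk atTop (𝓝 ys) ∧
    ∀ k, pair (xsk k) (-(((t k * ‖uk k‖) ^ (γ - 1))⁻¹ • ysk k)) ∈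
      regularNormalCone (gph Φ) (pair (x + t k • uk k) (y + t k • vk k))}

/-- The directional neighborhood `𝔹_{ε,δ}(u)` of `u`. -/
def dirNhd (ε δ : ℝ) (u : X) : Set X :=
  {v | ‖‖v‖ • u - ‖u‖ • v‖ ≤ δ * ‖u‖ * ‖v‖ ∧ ‖v‖ ≤ ε}

/-- Metric pseudo-subregularity of order `γ` of `Φ` at `(xb, yb)` in direction `u`.
Distances are extended-real-valued: the distance to the empty set is `∞`. -/
def MetricallyPseudoSubregular (γ : ℝ) (Φ : X → Set Y) (xb : X) (yb : Y) (u : X) : Prop :=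
  ∃ ε δ κ : ℝ, 0 < ε ∧ 0 < δ ∧ 0 < κ ∧ ∀ x : X, x - xb ∈ dirNhd ε δ u →
    ENNReal.ofReal (‖x - xb‖ ^ (γ - 1)) * Metric.infEDist x (invMap Φ yb) ≤
      ENNReal.ofReal κ * Metric.infEDist yb (Φ x)

/-- M-stationarity of `xb` for the problem `min φ(x)` subject to `yb ∈ Φ(x)`. -/
def IsMStationary (φ : X → ℝ) (Φ : X → Set Y) (xb : X) (yb : Y) : Prop :=
  yb ∈ Φ xb ∧ ∃ lam : Y, 0 ∈ limitingSubdiff φ xb + limitingCoderivative Φ xb yb lam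

/-- `u` is a critical (unit) direction at `xb` for the problem `min φ(x)` subject to
`yb ∈ Φ(x)`. The upper limit is taken in the extended reals. -/
def IsCriticalDirection (φ : X → ℝ) (Φ : X → Set Y) (xb : X) (yb : Y) (u : X) : Prop :=
  u ∈ Metric.sphere (0 : X) 1 ∧
  ∃ (uk : ℕ → X) (vk : ℕ → Y) (t : ℕ → ℝ),
    Tendsto uk atTop (𝓝 u) ∧ Tendsto vk atTop (𝓝 0) ∧ PosNull t ∧
    (∀ k, pair (xb + t k • uk k) (yb + t k • vk k) ∈ gph Φ) ∧
    limsup (fun k => (((φ (xb + t k • uk k) - φ xb) / t k : ℝ) : EReal)) atTop ≤ 0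

/-- Directional approximate stationarity of order `γ` at `xb` along `u`, with a diverging
sequence of multipliers `lam k`. -/
def IsApproxStationaryAlong (γ : ℝ) (φ : X → ℝ) (Φ : X → Set Y) (xb : X) (yb : Y) (u : X) :
    Prop :=
  ∃ (x x' η : ℕ → X) (y ys v lam : ℕ → Y) (yStar : Y),
    (∀ k, x k ∉ invMap Φ yb ∧ x' k ∉ invMap Φ yb ∧ y k ≠ yb ∧ ys k ≠ 0) ∧
    (∀ k, v k = (‖x k - xb‖ ^ γ)⁻¹ • (y k - yb)) ∧
    (∀ k, lam k = (‖x k - xb‖ ^ γ / ‖y k - yb‖) • ys k) ∧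
    Tendsto x atTop (𝓝 xb) ∧ Tendsto x' atTop (𝓝 xb) ∧ Tendsto y atTop (𝓝 yb) ∧
    Tendsto (fun k => ‖x k - xb‖⁻¹ • (x k - xb)) atTop (𝓝 u) ∧
    Tendsto (fun k => ‖x' k - xb‖⁻¹ • (x' k - xb)) atTop (𝓝 u) ∧
    Tendsto v atTop (𝓝 0) ∧
    Tendsto ys atTop (𝓝 yStar) ∧
    Tendsto (fun k => ‖lam k‖) atTop atTop ∧
    Tendsto η atTop (𝓝 0) ∧
    Tendsto (fun k => ‖y k - yb‖⁻¹ • (y k - yb) - ‖lam k‖⁻¹ • lam k) atTop (𝓝 0) ∧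
    ∀ k, η k ∈ regularSubdiff φ (x' k) +
      regularCoderivative Φ (x k) (y k) ((‖x k - xb‖ ^ (γ - 1))⁻¹ • lam k)

end Maps

end VarAnalysis

open VarAnalysis

/-!
Penalize the constraint: on the graph of `Φ`, the functions
`φ x + ‖x - xb‖ ^ 2 + c * ‖y - yb‖ ^ 2` with `c` large have local minimizers `(x, y)` close to
`(xb, yb)`, and a fuzzy sum rule turns each of them into an approximate multiplier rule whose
multiplier `λ` is nearly a positive multiple of `y - yb`. Comparing with the projection of `x` onto
`Φ⁻¹(yb)` gives `‖λ‖ * ‖y - yb‖ ≤ 2 * L * dist(x, Φ⁻¹(yb))`, where `L` is a Lipschitz constant of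
`φ`. If the multipliers have a bounded subsequence, the limit is M-stationarity. Otherwise this
estimate forces `(y - yb) / ‖x - xb‖ → 0`, so the limit direction `u` of `x - xb` is critical, and
the rescaled multipliers `‖x - xb‖ ^ (γ - 1) • λ` accumulate at zero, accumulate at a nonzero
vector, or diverge, which are the cases (ii), (iii) and (iv). Under pseudo-subregularity along `u`
the estimate bounds the rescaled multipliers, which excludes (iv).
-/

open NormedSpace (normalize)
open scoped NNReal

namespace VarAnalysis

section Penalization

variable {E : Type*} [TopologicalSpace E] [T2Space E] [LocallyCompactSpace E]

lemma exists_penalized_isLocalMinOn {Q : Set E} (hQ : IsClosed Q) {f g : E → ℝ} {q : E}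
    (hf : ∀ᶠ p in 𝓝 q, ContinuousAt f p) (hg : Continuous g) (hg₀ : ∀ p, 0 ≤ g p)
    (hq : q ∈ Q) (hgq : g q = 0) (hstrict : ∀ᶠ p in 𝓝[Q] q, g p = 0 → f p ≤ f q → p = q)
    {U : Set E} (hU : U ∈ 𝓝 q) :
    ∃ c > 0, ∃ p ∈ Q ∩ U, f p + c * g p ≤ f q ∧ IsLocalMinOn (fun z => f z + c * g z) Q p := by
  obtain ⟨K, hKq, hKU, hK⟩ :=
    local_compact_nhds (inter_mem hU (hf.and (eventually_nhdsWithin_iff.1 hstrict)))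
  have hKQ : IsCompact (K ∩ Q) := hK.inter_right hQ
  have hfK (c : ℝ) : ContinuousOn (fun p => f p + c * g p) (K ∩ Q) := fun p hp =>
    ((hKU hp.1).2.1.add (hg.continuousAt.const_mul c)).continuousWithinAt
  -- the sublevel sets of the penalized functions shrink to `q`
  let V (n : ℕ) : Set E := (K ∩ Q) ∩ (fun p => f p + (n + 1) * g p) ⁻¹' Set.Iic (f q)
  have hV (n : ℕ) : IsCompact (V n) := hKQ.of_isClosed_subset
    ((hfK _).preimage_isClosed_of_isClosed hKQ.isClosed isClosed_Iic) Set.inter_subset_left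
  have hVmono : Antitone V := fun m n hmn p hp => by
    have : ((m : ℝ) + 1) * g p ≤ (n + 1) * g p := by gcongr; exact hg₀ p
    exact ⟨hp.1, (add_le_add_right this (f p)).trans hp.2⟩
  have hVq : ∀ p ∈ ⋂ n, V n, p = q := fun p hp => by
    have hp (n : ℕ) := Set.mem_iInter.1 hp n
    have hpg : g p = 0 := by
      by_contra hne
      have hpos : 0 < g p := (hg₀ p).lt_of_ne' hne
      obtain ⟨n, hn⟩ := exists_nat_gt ((f q - f p) / g p)
      rw [div_lt_iff₀ hpos] at hn
      have : f p + (n + 1) * g p ≤ f q := (hp n).2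
      linarith
    exact (hKU (hp 0).1.1).2.2 (hp 0).1.2 hpg (by simpa [hpg] using (hp 0).2)
  obtain ⟨n, hn⟩ := exists_subset_nhds_of_isCompact hVmono.directed_ge hV (U := interior K)
    fun p hp => by rw [hVq p hp]; exact interior_mem_nhds.2 hKq
  obtain ⟨p, hpK, hp⟩ := hKQ.exists_isMinOn ⟨q, mem_of_mem_nhds hKq, hq⟩ (hfK (n + 1))
  have hpq : f p + (n + 1) * g p ≤ f q := by
    simpa [hgq] using hp (show q ∈ K ∩ Q from ⟨mem_of_mem_nhds hKq, hq⟩)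
  have hpint : interior K ∈ 𝓝 p := isOpen_interior.mem_nhds (hn ⟨hpK, hpq⟩)
  refine ⟨n + 1, by positivity, p, ⟨hpK.2, (hKU hpK.1).1⟩, hpq, ?_⟩
  filter_upwards [self_mem_nhdsWithin, nhdsWithin_le_nhds hpint] with z hzQ hzK
  exact hp ⟨interior_subset hzK, hzQ⟩

end Penalization

section RegularNormals

lemma tendsto_pair {X Y ι : Type*} [NormedAddCommGroup X] [NormedAddCommGroup Y] {l : Filter ι}
    {x : ι → X} {y : ι → Y} {a : X} {b : Y} (hx : Tendsto x l (𝓝 a)) (hy : Tendsto y l (𝓝 b)) :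
    Tendsto (fun i => pair (x i) (y i)) l (𝓝 (pair a b)) :=
  ((WithLp.prod_continuous_toLp 2 X Y).tendsto _).comp (hx.prodMk_nhds hy)

lemma pair_add_smul {X Y : Type*} [NormedAddCommGroup X] [NormedSpace ℝ X] [NormedAddCommGroup Y]
    [NormedSpace ℝ Y] (a u : X) (b v : Y) (t : ℝ) :
    pair a b + t • pair u v = pair (a + t • u) (b + t • v) :=
  rfl

variable {E : Type*} [NormedAddCommGroup E] [InnerProductSpace ℝ E]

lemma neg_mem_regularNormalCone_of_isLocalMinOn {Q : Set E} {f : E → ℝ} {x v : E} (hx : x ∈ Q)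
    (hmin : IsLocalMinOn f Q x) (hf : HasFDerivAt f (innerSL ℝ v) x) :
    -v ∈ regularNormalCone Q x := by
  refine ⟨hx, fun ε hε => ?_⟩
  filter_upwards [hmin, nhdsWithin_le_nhds (hf.isLittleO.def hε)] with z hz hz'
  rw [innerSL_apply_apply, Real.norm_eq_abs] at hz'
  rw [inner_neg_left]
  linarith [(abs_le.1 hz').2]

lemma hasFDerivAt_norm_sub_sq (x c : E) :
    HasFDerivAt (fun z => ‖z - c‖ ^ 2) (innerSL ℝ ((2 : ℝ) • (x - c))) x := by
  refine ((hasFDerivAt_id x).sub_const c).norm_sq.congr_fderiv ?_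
  ext z
  simp

lemma norm_le_of_eventually_inner_le {v : E} {C : ℝ} (hC : 0 ≤ C)
    (h : ∀ᶠ z in 𝓝 (0 : E), inner ℝ v z ≤ C * ‖z‖) : ‖v‖ ≤ C := by
  rw [← innerSL_apply_norm ℝ v]
  refine ContinuousLinearMap.opNorm_le_of_nhds_zero hC ?_
  have hneg : Tendsto (fun z : E => -z) (𝓝 0) (𝓝 0) := by
    simpa using (continuous_neg (G := E)).tendsto 0
  filter_upwards [h, hneg.eventually h] with z hz hz'
  rw [inner_neg_right, norm_neg] at hz'
  rw [innerSL_apply_apply, Real.norm_eq_abs, abs_le]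
  constructor <;> linarith

variable {X Y : Type*} [NormedAddCommGroup X] [InnerProductSpace ℝ X]
  [NormedAddCommGroup Y] [InnerProductSpace ℝ Y]

lemma hasFDerivAt_add_pair {f : X → ℝ} {g : Y → ℝ} {x u : X} {y v : Y}
    (hf : HasFDerivAt f (innerSL ℝ u) x) (hg : HasFDerivAt g (innerSL ℝ v) y) :
    HasFDerivAt (fun p : WithLp 2 (X × Y) => f p.fst + g p.snd) (innerSL ℝ (pair u v))
      (pair x y) := by
  have hfst : HasFDerivAt (fun p : WithLp 2 (X × Y) => p.fst) (WithLp.fstL 2 ℝ X Y) (pair x y) :=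
    (WithLp.fstL 2 ℝ X Y).hasFDerivAt
  have hsnd : HasFDerivAt (fun p : WithLp 2 (X × Y) => p.snd) (WithLp.sndL 2 ℝ X Y) (pair x y) :=
    (WithLp.sndL 2 ℝ X Y).hasFDerivAt
  refine ((hf.comp (pair x y) hfst).add (hg.comp (pair x y) hsnd)).congr_fderiv ?_
  ext p
  simp [WithLp.prod_inner_apply]

lemma neg_mem_regularSubdiff_of_isLocalMin {φ f : X → ℝ} {x v : X}
    (hmin : IsLocalMin (fun z => φ z + f z) x) (hf : HasFDerivAt f (innerSL ℝ v) x) :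
    -v ∈ regularSubdiff φ x := by
  have hid : HasFDerivAt (fun α : ℝ => α) (innerSL ℝ (1 : ℝ)) (φ x) := by
    refine (hasFDerivAt_id (φ x)).congr_fderiv ?_
    ext
    simp
  have hfst : Tendsto (fun p : WithLp 2 (X × ℝ) => p.fst) (𝓝[epi φ] (pair x (φ x))) (𝓝 x) :=
    ((WithLp.fstL 2 ℝ X ℝ).continuous.tendsto (pair x (φ x))).mono_left nhdsWithin_le_nhds
  have hepi : IsLocalMinOn (fun p : WithLp 2 (X × ℝ) => f p.fst + p.snd) (epi φ)
      (pair x (φ x)) := by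
    filter_upwards [hfst.eventually hmin, self_mem_nhdsWithin] with p hp hpe
    have hpe : φ p.fst ≤ p.snd := hpe
    change f x + φ x ≤ f p.fst + p.snd
    linarith
  simpa [regularSubdiff, ← WithLp.toLp_neg] using neg_mem_regularNormalCone_of_isLocalMinOn
    (show pair x (φ x) ∈ epi φ from le_refl (φ x)) hepi (hasFDerivAt_add_pair hf hid)

lemma norm_le_of_mem_regularSubdiff {φ : X → ℝ} {x ξ : X} {L : ℝ≥0} {N : Set X}
    (hN : N ∈ 𝓝 x) (hφ : LipschitzOnWith L φ N) (hξ : ξ ∈ regularSubdiff φ x) : ‖ξ‖ ≤ L := by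
  have hgraph : Tendsto (fun v => pair (x + v) (φ (x + v))) (𝓝 0) (𝓝[epi φ] (pair x (φ x))) := by
    have hx : Tendsto (fun v => x + v) (𝓝 0) (𝓝 x) := by
      simpa using (continuous_const_add x).tendsto 0
    exact tendsto_nhdsWithin_iff.2
      ⟨tendsto_pair hx ((hφ.continuousOn.continuousAt hN).tendsto.comp hx),
        Eventually.of_forall fun v => le_refl (φ (x + v))⟩
  have hNv : ∀ᶠ v in 𝓝 (0 : X), x + v ∈ N := by
    simpa using (continuous_const_add x).continuousAt.eventually_mem (by simpa using hN)
  have key (ε : ℝ) (hε : 0 < ε) : ‖ξ‖ ≤ L + ε * (1 + L) := by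
    refine norm_le_of_eventually_inner_le (by positivity) ?_
    filter_upwards [hgraph.eventually (hξ.2 ε hε), hNv] with v hv hvN
    have hlip : |φ (x + v) - φ x| ≤ L * ‖v‖ := by
      simpa using hφ.norm_sub_le hvN (mem_of_mem_nhds hN)
    have hnorm : ‖pair v (φ (x + v) - φ x)‖ ≤ ‖v‖ + L * ‖v‖ := by
      refine (abs_le_of_sq_le_sq' ?_ (by positivity)).2
      rw [WithLp.prod_norm_sq_eq_of_L2]
      change ‖v‖ ^ 2 + |φ (x + v) - φ x| ^ 2 ≤ (‖v‖ + L * ‖v‖) ^ 2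
      nlinarith [pow_le_pow_left₀ (abs_nonneg _) hlip 2, norm_nonneg v,
        mul_nonneg L.coe_nonneg (sq_nonneg ‖v‖)]
    have hsub : pair (x + v) (φ (x + v)) - pair x (φ x) = pair v (φ (x + v) - φ x) := by
      simp [← WithLp.toLp_sub]
    rw [hsub, WithLp.prod_inner_apply] at hv
    simp only [RCLike.inner_apply, conj_trivial] at hv
    nlinarith [(abs_le.1 hlip).2, mul_le_mul_of_nonneg_left hnorm hε.le]
  refine le_of_forall_pos_le_add fun δ hδ => ?_
  simpa [div_mul_cancel₀ δ (by positivity : (1 + L : ℝ) ≠ 0)]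
    using key (δ / (1 + L)) (by positivity)

end RegularNormals

section FuzzySum

variable {X Y : Type*} [NormedAddCommGroup X] [InnerProductSpace ℝ X]
  [NormedAddCommGroup Y] [InnerProductSpace ℝ Y]

/-- The tuples `(x, x', y, λ, η)` satisfying the fuzzy multiplier rule
`η ∈ ∂̂φ(x') + D̂*Φ(x, y)(λ)`. -/
def fuzzyMultipliers (φ : X → ℝ) (Φ : X → Set Y) : Set (X × X × Y × Y × X) :=
  {(x, x', y, lam, η) : X × X × Y × Y × X | η ∈ regularSubdiff φ x' + regularCoderivative Φ x y lam}

lemma neg_mem_add_of_isLocalMinOn_decoupled {φ : X → ℝ} {Φ : X → Set Y} {f : X → ℝ} {g : Y → ℝ}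
    {x x' u : X} {y v : Y} {c : ℝ} (hy : y ∈ Φ x) (hf : HasFDerivAt f (innerSL ℝ u) x)
    (hg : HasFDerivAt g (innerSL ℝ v) y)
    (hmin : IsLocalMinOn (fun z : X × WithLp 2 (X × Y) =>
      φ z.1 + f z.2.fst + g z.2.snd + c * ‖z.1 - z.2.fst‖ ^ 2) (Set.univ ×ˢ gph Φ)
      (x', pair x y)) :
    -u ∈ regularSubdiff φ x' + regularCoderivative Φ x y v := by
  have hcoupling (z w : X) :
      HasFDerivAt (fun z => c * ‖z - w‖ ^ 2) (innerSL ℝ (c • (2 : ℝ) • (z - w))) z :=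
    ((hasFDerivAt_norm_sub_sq z w).const_mul c).congr_fderiv (by simp only [map_smul])
  rw [IsLocalMinOn, IsMinFilter, nhdsWithin_prod_eq, nhdsWithin_univ] at hmin
  have hsub : -(c • (2 : ℝ) • (x' - x)) ∈ regularSubdiff φ x' := by
    refine neg_mem_regularSubdiff_of_isLocalMin ?_ (hcoupling x' x)
    filter_upwards [hmin.curry] with z hz
    have : φ x' + f x + g y + c * ‖x' - x‖ ^ 2 ≤ φ z + f x + g y + c * ‖z - x‖ ^ 2 :=
      hz.self_of_nhdsWithin hy
    linarith
  have hcod : -(u + c • (2 : ℝ) • (x - x')) ∈ regularCoderivative Φ x y v := by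
    have hgrad := hf.add (hcoupling x x')
    rw [← map_add] at hgrad
    have := neg_mem_regularNormalCone_of_isLocalMinOn (Q := gph Φ) hy ?_
      (hasFDerivAt_add_pair hgrad hg)
    · simpa [regularCoderivative, ← WithLp.toLp_neg] using this
    · have hslice : Tendsto (fun w : WithLp 2 (X × Y) => (x', w)) (𝓝[gph Φ] (pair x y))
          (𝓝 x' ×ˢ 𝓝[gph Φ] (pair x y)) := tendsto_const_nhds.prodMk tendsto_id
      filter_upwards [hslice.eventually hmin] with w hw
      simp only [norm_sub_rev x'] at hw
      simp only [Pi.add_apply]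
      linarith
  convert Set.add_mem_add hsub hcod using 1
  module

variable [FiniteDimensional ℝ X] [FiniteDimensional ℝ Y] {φ : X → ℝ} {Φ : X → Set Y}
  {f : X → ℝ} {f' : X → X} {g : Y → ℝ} {g' : Y → Y} {a : X} {b : Y}

lemma mem_closure_fuzzyMultipliers_of_strict (hΦ : IsClosed (gph Φ))
    (hφ : ∀ᶠ x in 𝓝 a, ContinuousAt φ x)
    (hf : ∀ x, HasFDerivAt f (innerSL ℝ (f' x)) x) (hf' : ContinuousAt f' a)
    (hg : ∀ y, HasFDerivAt g (innerSL ℝ (g' y)) y) (hg' : ContinuousAt g' b) (hb : b ∈ Φ a)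
    (hstrict : ∀ᶠ w in 𝓝[gph Φ] (pair a b),
      φ w.fst + f w.fst + g w.snd ≤ φ a + f a + g b → w = pair a b) :
    (a, a, b, g' b, -f' a) ∈ closure (fuzzyMultipliers φ Φ) := by
  let Ψ (z : X × WithLp 2 (X × Y)) : X × X × Y × Y × X :=
    (z.2.fst, z.1, z.2.snd, g' z.2.snd, -f' z.2.fst)
  have hfst : Continuous fun z : X × WithLp 2 (X × Y) => z.2.fst := by fun_prop
  have hsnd : Continuous fun z : X × WithLp 2 (X × Y) => z.2.snd := by fun_prop
  have hΨ : ContinuousAt Ψ (a, pair a b) := by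
    have hx : ContinuousAt (fun z : X × WithLp 2 (X × Y) => f' z.2.fst) (a, pair a b) :=
      hf'.comp_of_eq hfst.continuousAt rfl
    have hy : ContinuousAt (fun z : X × WithLp 2 (X × Y) => g' z.2.snd) (a, pair a b) :=
      hg'.comp_of_eq hsnd.continuousAt rfl
    exact hfst.continuousAt.prodMk (continuousAt_fst.prodMk (hsnd.continuousAt.prodMk
      (hy.prodMk hx.neg)))
  have hcont : ∀ᶠ z in 𝓝 (a, pair a b),
      ContinuousAt (fun z : X × WithLp 2 (X × Y) => φ z.1 + f z.2.fst + g z.2.snd) z := by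
    filter_upwards [continuous_fst.continuousAt.eventually hφ] with z hz
    exact ((hz.comp continuous_fst.continuousAt).add
      ((hf _).continuousAt.comp hfst.continuousAt)).add ((hg _).continuousAt.comp hsnd.continuousAt)
  have hstrict' : ∀ᶠ z in 𝓝[Set.univ ×ˢ gph Φ] (a, pair a b), ‖z.1 - z.2.fst‖ ^ 2 = 0 →
      φ z.1 + f z.2.fst + g z.2.snd ≤ φ a + f a + g b → z = (a, pair a b) := by
    rw [nhdsWithin_prod_eq]
    filter_upwards [tendsto_snd.eventually hstrict] with ⟨x', w⟩ hw hx' hle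
    obtain rfl : x' = w.fst := by simpa [sub_eq_zero] using hx'
    obtain rfl : w = pair a b := hw hle
    rfl
  rw [mem_closure_iff_nhds]
  intro t ht
  obtain ⟨c, -, ⟨x', w⟩, ⟨hw, hwt⟩, -, hloc⟩ := exists_penalized_isLocalMinOn
    (isClosed_univ.prod hΦ) hcont (by fun_prop) (fun z => sq_nonneg ‖z.1 - z.2.fst‖)
    ⟨Set.mem_univ a, hb⟩ (by simp) hstrict' (hΨ ht)
  exact ⟨_, hwt, neg_mem_add_of_isLocalMinOn_decoupled hw.2 (hf _) (hg _) hloc⟩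

lemma mem_closure_fuzzyMultipliers_of_isLocalMinOn (hΦ : IsClosed (gph Φ))
    (hφ : ∀ᶠ x in 𝓝 a, ContinuousAt φ x)
    (hf : ∀ x, HasFDerivAt f (innerSL ℝ (f' x)) x) (hf' : ContinuousAt f' a)
    (hg : ∀ y, HasFDerivAt g (innerSL ℝ (g' y)) y) (hg' : ContinuousAt g' b) (hb : b ∈ Φ a)
    (hmin : IsLocalMinOn (fun p => φ p.fst + f p.fst + g p.snd) (gph Φ) (pair a b)) :
    (a, a, b, g' b, -f' a) ∈ closure (fuzzyMultipliers φ Φ) := by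
  -- adding the squared distance to `(a, b)` makes the minimizer strict
  let F (x : X) : ℝ := f x + ‖x - a‖ ^ 2
  let G (y : Y) : ℝ := g y + ‖y - b‖ ^ 2
  have hF (x : X) : HasFDerivAt F (innerSL ℝ (f' x + (2 : ℝ) • (x - a))) x := by
    rw [map_add]
    exact (hf x).add (hasFDerivAt_norm_sub_sq x a)
  have hG (y : Y) : HasFDerivAt G (innerSL ℝ (g' y + (2 : ℝ) • (y - b))) y := by
    rw [map_add]
    exact (hg y).add (hasFDerivAt_norm_sub_sq y b)
  have hstrict : ∀ᶠ w in 𝓝[gph Φ] (pair a b),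
      φ w.fst + F w.fst + G w.snd ≤ φ a + F a + G b → w = pair a b := by
    filter_upwards [hmin] with w hw hle
    have hw : φ a + f a + g b ≤ φ w.fst + f w.fst + g w.snd := hw
    simp only [F, G, sub_self, norm_zero, ne_eq, two_ne_zero, not_false_eq_true, zero_pow,
      add_zero] at hle
    have hfst : ‖w.fst - a‖ ^ 2 = 0 := by nlinarith [sq_nonneg ‖w.fst - a‖, sq_nonneg ‖w.snd - b‖]
    have hsnd : ‖w.snd - b‖ ^ 2 = 0 := by nlinarith [sq_nonneg ‖w.fst - a‖, sq_nonneg ‖w.snd - b‖]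
    refine WithLp.ofLp_injective 2 (Prod.ext ?_ ?_)
    · simpa [sub_eq_zero] using hfst
    · simpa [sub_eq_zero] using hsnd
  simpa using mem_closure_fuzzyMultipliers_of_strict hΦ hφ hF (by fun_prop) hG (by fun_prop) hb
    hstrict

end FuzzySum

section MStationarity

variable {X Y : Type*} [NormedAddCommGroup X] [InnerProductSpace ℝ X]
  [NormedAddCommGroup Y] [InnerProductSpace ℝ Y] {φ : X → ℝ} {Φ : X → Set Y}

lemma mem_limitingSubdiff_of_tendsto {a ξ₀ : X} {x ξ : ℕ → X} (hφ : ContinuousAt φ a)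
    (hx : Tendsto x atTop (𝓝 a)) (hξ : Tendsto ξ atTop (𝓝 ξ₀))
    (hsub : ∀ n, ξ n ∈ regularSubdiff φ (x n)) : ξ₀ ∈ limitingSubdiff φ a :=
  ⟨le_refl (φ a), fun n => pair (x n) (φ (x n)), fun n => pair (ξ n) (-1), fun n => (hsub n).1,
    tendsto_pair hx (hφ.tendsto.comp hx), tendsto_pair hξ tendsto_const_nhds, hsub⟩

lemma mem_limitingCoderivative_of_tendsto {a η : X} {b l : Y} {x xs : ℕ → X} {y lam : ℕ → Y}
    (hb : b ∈ Φ a) (hx : Tendsto x atTop (𝓝 a)) (hy : Tendsto y atTop (𝓝 b))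
    (hlam : Tendsto lam atTop (𝓝 l)) (hxs : Tendsto xs atTop (𝓝 η))
    (hcod : ∀ n, xs n ∈ regularCoderivative Φ (x n) (y n) (lam n)) :
    η ∈ limitingCoderivative Φ a b l :=
  ⟨hb, fun n => pair (x n) (y n), fun n => pair (xs n) (-lam n), fun n => (hcod n).1,
    tendsto_pair hx hy, tendsto_pair hxs hlam.neg, hcod⟩

lemma isMStationary_of_mem_closure_fuzzyMultipliers [FiniteDimensional ℝ X] {L : ℝ≥0} {N : Set X}
    {xb : X} {yb lam : Y} (hN : N ∈ 𝓝 xb) (hφ : LipschitzOnWith L φ N) (hfeas : xb ∈ invMap Φ yb)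
    (h : (xb, xb, yb, lam, 0) ∈ closure (fuzzyMultipliers φ Φ)) : IsMStationary φ Φ xb yb := by
  obtain ⟨m, hm, hlim⟩ := mem_closure_iff_seq_limit.1 h
  choose ξ hξ xs hxs hsum using fun n => Set.mem_add.1 (hm n)
  simp only [nhds_prod_eq, tendsto_prod_iff'] at hlim
  obtain ⟨hx, hx', hy, hlam, hη⟩ := hlim
  have hbdd : ∀ᶠ n in atTop, ξ n ∈ Metric.closedBall 0 (L : ℝ) := by
    filter_upwards [hx'.eventually (eventually_mem_nhds_iff.2 hN)] with n hn
    simpa using norm_le_of_mem_regularSubdiff hn hφ (hξ n)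
  obtain ⟨ξ₀, -, σ, hσ, hξ₀⟩ := tendsto_subseq_of_frequently_bounded Metric.isBounded_closedBall
    hbdd.frequently
  have hσ := hσ.tendsto_atTop
  have hxs₀ : Tendsto (xs ∘ σ) atTop (𝓝 (-ξ₀)) := by
    refine zero_sub ξ₀ ▸ ((hη.comp hσ).sub hξ₀).congr fun n => ?_
    simp [← hsum]
  exact ⟨hfeas, lam, Set.mem_add.2 ⟨ξ₀, mem_limitingSubdiff_of_tendsto
      (hφ.continuousOn.continuousAt hN) (hx'.comp hσ) hξ₀ fun n => hξ (σ n),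
    -ξ₀, mem_limitingCoderivative_of_tendsto hfeas (hx.comp hσ) (hy.comp hσ) (hlam.comp hσ) hxs₀
      fun n => hxs (σ n), add_neg_cancel ξ₀⟩⟩

end MStationarity

section PenaltyMinimizers

lemma eventually_le_add_mul_infDist {M : Type*} [PseudoMetricSpace M] [ProperSpace M] {φ : M → ℝ}
    {S N : Set M} {a : M} {L : ℝ≥0} (hN : N ∈ 𝓝 a) (hφ : LipschitzOnWith L φ N) (hS : IsClosed S)
    (ha : a ∈ S) (hmin : IsLocalMinOn φ S a) :
    ∀ᶠ x in 𝓝 a, φ a ≤ φ x + L * Metric.infDist x S := by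
  obtain ⟨ε, hε, hball⟩ := Metric.mem_nhds_iff.1
    (inter_mem hN (eventually_nhdsWithin_iff.1 hmin))
  filter_upwards [Metric.ball_mem_nhds a (half_pos hε), hN] with x hx hxN
  obtain ⟨p, hpS, hp⟩ := hS.exists_infDist_eq_dist ⟨a, ha⟩ x
  have hpx : dist p x ≤ dist x a := by
    rw [dist_comm, ← hp]
    exact Metric.infDist_le_dist_of_mem ha
  have hpball : p ∈ Metric.ball a ε := by
    rw [Metric.mem_ball] at hx ⊢
    linarith [dist_triangle p x a]
  have hlip := hφ.dist_le_mul p (hball hpball).1 x hxN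
  rw [Real.dist_eq, dist_comm p, ← hp] at hlip
  linarith [(hball hpball).2 hpS, le_abs_self (φ p - φ x)]

lemma isClosed_invMap {X Y : Type*} [NormedAddCommGroup X] [NormedAddCommGroup Y] {Φ : X → Set Y}
    (hΦ : IsClosed (gph Φ)) (y : Y) : IsClosed (invMap Φ y) :=
  hΦ.preimage (f := fun x => pair x y) (by fun_prop)

variable {X Y : Type*} [NormedAddCommGroup X] [InnerProductSpace ℝ X] [FiniteDimensional ℝ X]
  [NormedAddCommGroup Y] [InnerProductSpace ℝ Y] [FiniteDimensional ℝ Y]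
  {φ : X → ℝ} {Φ : X → Set Y} {xb : X} {yb : Y}

lemma exists_penalized_mem_closure_fuzzyMultipliers (hφ : ∀ᶠ x in 𝓝 xb, ContinuousAt φ x)
    (hΦ : IsClosed (gph Φ)) (hfeas : xb ∈ invMap Φ yb) (hmin : IsLocalMinOn φ (invMap Φ yb) xb)
    {U : Set (X × Y)} (hU : U ∈ 𝓝 (xb, yb)) :
    ∃ c : ℝ, 0 < c ∧ ∃ a b, (a, b) ∈ U ∧ b ∈ Φ a ∧
      φ a + ‖a - xb‖ ^ 2 + c * ‖b - yb‖ ^ 2 ≤ φ xb ∧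
      (a, a, b, c • (2 : ℝ) • (b - yb), -((2 : ℝ) • (a - xb))) ∈
        closure (fuzzyMultipliers φ Φ) := by
  have hfst : Continuous fun p : WithLp 2 (X × Y) => p.fst := by fun_prop
  have hφ' : ∀ᶠ p in 𝓝 (pair xb yb), ∀ᶠ x in 𝓝 p.fst, ContinuousAt φ x :=
    (hfst.tendsto (pair xb yb)).eventually hφ.eventually_nhds
  have hmin' : ∀ᶠ p in 𝓝 (pair xb yb), p.fst ∈ invMap Φ yb → φ xb ≤ φ p.fst :=
    (hfst.tendsto (pair xb yb)).eventually (eventually_nhdsWithin_iff.1 hmin)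
  have hcont : ∀ᶠ p in 𝓝 (pair xb yb),
      ContinuousAt (fun p : WithLp 2 (X × Y) => φ p.fst + ‖p.fst - xb‖ ^ 2) p := by
    filter_upwards [hφ'] with p hp
    exact (hp.self_of_nhds.comp hfst.continuousAt).add (by fun_prop)
  have hstrict : ∀ᶠ p in 𝓝[gph Φ] (pair xb yb), ‖p.snd - yb‖ ^ 2 = 0 →
      φ p.fst + ‖p.fst - xb‖ ^ 2 ≤ φ xb + ‖xb - xb‖ ^ 2 → p = pair xb yb := by
    filter_upwards [nhdsWithin_le_nhds hmin', self_mem_nhdsWithin] with p hp hpg hsnd hle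
    have hsnd : p.snd = yb := by simpa [sub_eq_zero] using hsnd
    have hle' := hp (hsnd ▸ hpg)
    have hfst : ‖p.fst - xb‖ ^ 2 = 0 := le_antisymm (by simp at hle; linarith) (sq_nonneg _)
    exact WithLp.ofLp_injective 2 (Prod.ext (by simpa [sub_eq_zero] using hfst) hsnd)
  have hU' : ∀ᶠ p : WithLp 2 (X × Y) in 𝓝 (pair xb yb), (p.fst, p.snd) ∈ U :=
    (WithLp.prod_continuous_ofLp 2 X Y).continuousAt hU
  obtain ⟨c, hc, p, ⟨hpg, hpU, hpφ⟩, hval, hloc⟩ := exists_penalized_isLocalMinOn hΦ hcont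
    (by fun_prop) (fun p => sq_nonneg ‖p.snd - yb‖) hfeas (by simp) hstrict (inter_mem hU' hφ')
  have hpenalty (y : Y) :
      HasFDerivAt (fun y => c * ‖y - yb‖ ^ 2) (innerSL ℝ (c • (2 : ℝ) • (y - yb))) y :=
    ((hasFDerivAt_norm_sub_sq y yb).const_mul c).congr_fderiv (by simp only [map_smul])
  exact ⟨c, hc, p.fst, p.snd, hpU, hpg, by simpa using hval,
    mem_closure_fuzzyMultipliers_of_isLocalMinOn hΦ hpφ (fun x => hasFDerivAt_norm_sub_sq x xb)
      (by fun_prop) hpenalty (by fun_prop) hpg hloc⟩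

end PenaltyMinimizers

lemma exists_tendsto_subseq_of_not_tendsto_norm {E : Type*} [NormedAddCommGroup E] [ProperSpace E]
    {z : ℕ → E} (h : ¬ Tendsto (fun n => ‖z n‖) atTop atTop) :
    ∃ a, ∃ s : ℕ → ℕ, StrictMono s ∧ Tendsto (z ∘ s) atTop (𝓝 a) := by
  rw [tendsto_atTop] at h
  push Not at h
  obtain ⟨R, hR⟩ := h
  obtain ⟨a, -, s, hs, ha⟩ := tendsto_subseq_of_frequently_bounded
    (Metric.isBounded_closedBall (x := (0 : E)) (r := R)) (x := z)
    (hR.mono fun n hn => by simpa using hn.le)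
  exact ⟨a, s, hs, ha⟩

section PenaltyMultipliers

variable {X Y : Type*} [NormedAddCommGroup X] [InnerProductSpace ℝ X]
  [NormedAddCommGroup Y] [InnerProductSpace ℝ Y]

/-- A multiplier `λ` produced by the penalization near `(xb, yb)`, where `φ` has Lipschitz
constant `L`: it satisfies a fuzzy multiplier rule with the subgradient `ξ` of `φ` at `x'` and the
coderivative element `x* = xs` of `Φ` at `(x, y)`. -/
structure PenaltyMultiplier (φ : X → ℝ) (Φ : X → Set Y) (xb : X) (yb : Y) (L : ℝ≥0) where
  (x x' ξ xs : X)
  (y lam : Y)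
  notMem : x ∉ invMap Φ yb
  notMem' : x' ∉ invMap Φ yb
  value_lt : φ x < φ xb
  inner_pos : 0 < inner ℝ lam (y - yb)
  norm_mul_le : ‖lam‖ * ‖y - yb‖ ≤ 2 * L * Metric.infDist x (invMap Φ yb)
  norm_subgradient_le : ‖ξ‖ ≤ L
  subgradient : ξ ∈ regularSubdiff φ x'
  coderivative : xs ∈ regularCoderivative Φ x y lam

variable {φ : X → ℝ} {Φ : X → Set Y} {xb : X} {yb : Y} {L : ℝ≥0}

namespace PenaltyMultiplier

/-- The tuple of `fuzzyMultipliers φ Φ` underlying a penalty multiplier. -/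
def toTuple (p : PenaltyMultiplier φ Φ xb yb L) : X × X × Y × Y × X :=
  (p.x, p.x', p.y, p.lam, p.ξ + p.xs)

lemma toTuple_mem (p : PenaltyMultiplier φ Φ xb yb L) : p.toTuple ∈ fuzzyMultipliers φ Φ :=
  Set.add_mem_add p.subgradient p.coderivative

lemma mem_closure_range_toTuple {N : Set X} {a η : X} {b m : Y}
    (hφ : LipschitzOnWith L φ N) (hN : N ∈ 𝓝 a) (hS : IsClosed (invMap Φ yb))
    (ha : a ∉ invMap Φ yb) (hval : φ a < φ xb) (hinner : 0 < inner ℝ m (b - yb))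
    (hnorm : ‖m‖ * ‖b - yb‖ < 2 * L * Metric.infDist a (invMap Φ yb))
    (h : (a, a, b, m, η) ∈ closure (fuzzyMultipliers φ Φ)) :
    (a, a, b, m, η) ∈
      closure (Set.range (toTuple : PenaltyMultiplier φ Φ xb yb L → X × X × Y × Y × X)) := by
  have hx : Tendsto (fun z : X × X × Y × Y × X => z.1) (𝓝 (a, a, b, m, η)) (𝓝 a) :=
    continuous_fst.tendsto _
  have hx' : Tendsto (fun z : X × X × Y × Y × X => z.2.1) (𝓝 (a, a, b, m, η)) (𝓝 a) :=
    (continuous_fst.comp continuous_snd).tendsto _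
  have hinner' : ∀ᶠ z : X × X × Y × Y × X in 𝓝 (a, a, b, m, η),
      0 < inner ℝ z.2.2.2.1 (z.2.2.1 - yb) :=
    ContinuousAt.eventually_lt (by fun_prop) (by fun_prop) hinner
  have hnorm' : ∀ᶠ z : X × X × Y × Y × X in 𝓝 (a, a, b, m, η),
      ‖z.2.2.2.1‖ * ‖z.2.2.1 - yb‖ < 2 * L * Metric.infDist z.1 (invMap Φ yb) :=
    ContinuousAt.eventually_lt (by fun_prop) (by fun_prop) hnorm
  rw [mem_closure_iff_frequently] at h ⊢
  refine h.mp ?_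
  filter_upwards [hx.eventually (hS.isOpen_compl.eventually_mem ha),
    hx'.eventually (hS.isOpen_compl.eventually_mem ha),
    hx.eventually ((hφ.continuousOn.continuousAt hN).eventually_lt_const hval),
    hx'.eventually (eventually_mem_nhds_iff.2 hN), hinner', hnorm']
  rintro ⟨x, x', y, lam, _⟩ hx hx' hval hN hinner hnorm ⟨ξ, hξ, xs, hxs, rfl⟩
  exact ⟨⟨x, x', ξ, xs, y, lam, hx, hx', hval, hinner, hnorm.le,
    norm_le_of_mem_regularSubdiff hN hφ hξ, hξ, hxs⟩, rfl⟩

lemma mem_closure_range_toTuple_of_penalized {N : Set X} {a : X} {b : Y} {c : ℝ}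
    (hφ : LipschitzOnWith L φ N) (hN : N ∈ 𝓝 a) (hS : IsClosed (invMap Φ yb))
    (hfeas : xb ∈ invMap Φ yb) (ha : a ∉ invMap Φ yb) (hc : 0 < c) (hb : b ∈ Φ a)
    (hval : φ a + ‖a - xb‖ ^ 2 + c * ‖b - yb‖ ^ 2 ≤ φ xb)
    (hpen : φ xb ≤ φ a + L * Metric.infDist a (invMap Φ yb))
    (h : (a, a, b, c • (2 : ℝ) • (b - yb), -((2 : ℝ) • (a - xb))) ∈
      closure (fuzzyMultipliers φ Φ)) :
    (a, a, b, c • (2 : ℝ) • (b - yb), -((2 : ℝ) • (a - xb))) ∈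
      closure (Set.range (toTuple : PenaltyMultiplier φ Φ xb yb L → X × X × Y × Y × X)) := by
  have hxpos : 0 < ‖a - xb‖ ^ 2 := by
    have : a ≠ xb := fun h => ha (h ▸ hfeas)
    have := sub_ne_zero.2 this
    positivity
  have hypos : 0 < c * ‖b - yb‖ ^ 2 := by
    have : b ≠ yb := fun h => ha (h ▸ hb)
    have := sub_ne_zero.2 this
    positivity
  refine mem_closure_range_toTuple hφ hN hS ha (by linarith) ?_ ?_ h
  · rw [inner_smul_left, inner_smul_left, real_inner_self_eq_norm_sq]
    simp only [conj_trivial]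
    linarith
  · rw [norm_smul_of_nonneg hc.le, norm_smul_of_nonneg zero_le_two]
    linarith

/-- The quantities that vanish along the sequences of the theorem: the distances to `(xb, yb)`, the
residual of the multiplier rule, and the differences of directions. -/
noncomputable def deviation (xb : X) (yb : Y) : X × X × Y × Y × X → X × X × Y × X × X × Y :=
  fun (x, x', y, lam, η) => (x - xb, x' - xb, y - yb, η,
    normalize (x' - xb) - normalize (x - xb), normalize (y - yb) - normalize lam)

lemma continuousAt_deviation {x x' η : X} {y lam : Y} (hx : x ≠ xb) (hx' : x' ≠ xb) (hy : y ≠ yb)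
    (hlam : lam ≠ 0) : ContinuousAt (deviation xb yb) (x, x', y, lam, η) := by
  replace hx : ‖x - xb‖ ≠ 0 := norm_ne_zero_iff.2 (sub_ne_zero.2 hx)
  replace hx' : ‖x' - xb‖ ≠ 0 := norm_ne_zero_iff.2 (sub_ne_zero.2 hx')
  replace hy : ‖y - yb‖ ≠ 0 := norm_ne_zero_iff.2 (sub_ne_zero.2 hy)
  replace hlam : ‖lam‖ ≠ 0 := norm_ne_zero_iff.2 hlam
  change ContinuousAt (fun z : X × X × Y × Y × X => (z.1 - xb, z.2.1 - xb, z.2.2.1 - yb, z.2.2.2.2,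
    ‖z.2.1 - xb‖⁻¹ • (z.2.1 - xb) - ‖z.1 - xb‖⁻¹ • (z.1 - xb),
    ‖z.2.2.1 - yb‖⁻¹ • (z.2.2.1 - yb) - ‖z.2.2.2.1‖⁻¹ • z.2.2.2.1)) _
  fun_prop (disch := assumption)

lemma mem_closure_range_deviation {a η : X} {b : Y} {c : ℝ} (hfeas : xb ∈ invMap Φ yb)
    (ha : a ∉ invMap Φ yb) (hb : b ∈ Φ a) (hc : 0 < c)
    (h : (a, a, b, c • (b - yb), η) ∈
      closure (Set.range (toTuple : PenaltyMultiplier φ Φ xb yb L → X × X × Y × Y × X))) :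
    (a - xb, a - xb, b - yb, η, 0, 0) ∈
      closure (Set.range fun p : PenaltyMultiplier φ Φ xb yb L => deviation xb yb p.toTuple) := by
  have hax : a ≠ xb := fun h => ha (h ▸ hfeas)
  have hby : b ≠ yb := fun h => ha (h ▸ hb)
  have hdev : deviation xb yb (a, a, b, c • (b - yb), η) = (a - xb, a - xb, b - yb, η, 0, 0) := by
    simp [deviation, NormedSpace.normalize_smul_of_pos hc]
  have hcont := continuousAt_deviation (η := η) hax hax hby
    (smul_ne_zero hc.ne' (sub_ne_zero.2 hby))
  have := mem_closure_image hcont h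
  rwa [hdev, ← Set.range_comp] at this

lemma isMStationary_or_zero_mem_closure [FiniteDimensional ℝ X] [FiniteDimensional ℝ Y] {N : Set X}
    (hφ : LipschitzOnWith L φ N) (hN : N ∈ 𝓝 xb) (hΦ : IsClosed (gph Φ))
    (hfeas : xb ∈ invMap Φ yb) (hmin : IsLocalMinOn φ (invMap Φ yb) xb) :
    IsMStationary φ Φ xb yb ∨
      0 ∈ closure (Set.range fun p : PenaltyMultiplier φ Φ xb yb L =>
        deviation xb yb p.toTuple) := by
  refine or_iff_not_imp_left.2 fun hM => ?_
  rw [mem_closure_iff]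
  intro W hW hW₀
  have hlim : ∀ᶠ q : X × Y in 𝓝 (xb, yb),
      (q.1 - xb, q.1 - xb, q.2 - yb, -((2 : ℝ) • (q.1 - xb)), 0, 0) ∈ W :=
    ContinuousAt.eventually_mem (by fun_prop) (hW.mem_nhds (by simpa [← Prod.zero_eq_mk] using hW₀))
  have hnear : ∀ᶠ q : X × Y in 𝓝 (xb, yb),
      N ∈ 𝓝 q.1 ∧ φ xb ≤ φ q.1 + L * Metric.infDist q.1 (invMap Φ yb) :=
    (continuous_fst.tendsto (xb, yb)).eventually ((eventually_mem_nhds_iff.2 hN).and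
      (eventually_le_add_mul_infDist hN hφ (isClosed_invMap hΦ yb) hfeas hmin))
  have hcont : ∀ᶠ x in 𝓝 xb, ContinuousAt φ x :=
    (eventually_mem_nhds_iff.2 hN).mono fun x hx => hφ.continuousOn.continuousAt hx
  obtain ⟨c, hc, a, b, ⟨hab, hNa, hpen⟩, hb, hval, hcl⟩ :=
    exists_penalized_mem_closure_fuzzyMultipliers hcont hΦ hfeas hmin (inter_mem hlim hnear)
  have ha : a ∉ invMap Φ yb := fun ha => hM <| by
    rw [Metric.infDist_zero_of_mem ha, mul_zero, add_zero] at hpen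
    have hx : ‖a - xb‖ ^ 2 = 0 := by
      nlinarith [sq_nonneg ‖a - xb‖, mul_nonneg hc.le (sq_nonneg ‖b - yb‖)]
    have hy : c * ‖b - yb‖ ^ 2 = 0 := by
      nlinarith [sq_nonneg ‖a - xb‖, mul_nonneg hc.le (sq_nonneg ‖b - yb‖)]
    obtain rfl : a = xb := by simpa [sub_eq_zero] using hx
    obtain rfl : b = yb := by simpa [sub_eq_zero, hc.ne'] using hy
    exact isMStationary_of_mem_closure_fuzzyMultipliers hN hφ hfeas (by simpa using hcl)
  have hclosure := mem_closure_range_toTuple_of_penalized hφ hNa (isClosed_invMap hΦ yb) hfeas ha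
    hc hb hval hpen hcl
  rw [smul_smul] at hclosure
  have hdev := mem_closure_range_deviation hfeas ha hb (by positivity) hclosure
  exact mem_closure_iff.1 hdev W hW hab

lemma x_sub_ne_zero (p : PenaltyMultiplier φ Φ xb yb L) : p.x - xb ≠ 0 :=
  sub_ne_zero.2 fun h => p.value_lt.ne (congrArg φ h)

lemma norm_x_sub_pos (p : PenaltyMultiplier φ Φ xb yb L) : 0 < ‖p.x - xb‖ :=
  norm_pos_iff.2 p.x_sub_ne_zero

lemma y_sub_ne_zero (p : PenaltyMultiplier φ Φ xb yb L) : p.y - yb ≠ 0 := fun h =>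
  p.inner_pos.ne' (by rw [h, inner_zero_right])

lemma lam_ne_zero (p : PenaltyMultiplier φ Φ xb yb L) : p.lam ≠ 0 := fun h =>
  p.inner_pos.ne' (by rw [h, inner_zero_left])

lemma add_smul_normalize (p : PenaltyMultiplier φ Φ xb yb L) :
    xb + ‖p.x - xb‖ • normalize (p.x - xb) = p.x := by
  rw [NormedSpace.norm_smul_normalize, add_sub_cancel]

/-- The vector `v^γ = (y - yb) / ‖x - xb‖ ^ γ` of the theorem. -/
noncomputable def scaledValue (γ : ℝ) (p : PenaltyMultiplier φ Φ xb yb L) : Y :=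
  (‖p.x - xb‖ ^ γ)⁻¹ • (p.y - yb)

/-- The multiplier `λ^γ` of the theorem: it enters the multiplier rule as
`λ^γ / ‖x - xb‖ ^ (γ - 1)`. -/
noncomputable def scaledMultiplier (γ : ℝ) (p : PenaltyMultiplier φ Φ xb yb L) : Y :=
  ‖p.x - xb‖ ^ (γ - 1) • p.lam

lemma scaledMultiplier_one (p : PenaltyMultiplier φ Φ xb yb L) :
    p.scaledMultiplier 1 = p.lam := by
  simp [scaledMultiplier]

lemma scaledMultiplier_ne_zero (γ : ℝ) (p : PenaltyMultiplier φ Φ xb yb L) :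
    p.scaledMultiplier γ ≠ 0 :=
  smul_ne_zero (Real.rpow_pos_of_pos p.norm_x_sub_pos _).ne' p.lam_ne_zero

lemma normalize_scaledMultiplier (γ : ℝ) (p : PenaltyMultiplier φ Φ xb yb L) :
    normalize (p.scaledMultiplier γ) = normalize p.lam :=
  NormedSpace.normalize_smul_of_pos (Real.rpow_pos_of_pos p.norm_x_sub_pos _) _

lemma inv_smul_scaledMultiplier (γ : ℝ) (p : PenaltyMultiplier φ Φ xb yb L) :
    (‖p.x - xb‖ ^ (γ - 1))⁻¹ • p.scaledMultiplier γ = p.lam :=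
  inv_smul_smul₀ (Real.rpow_pos_of_pos p.norm_x_sub_pos _).ne' _

lemma add_smul_scaledValue (γ : ℝ) (p : PenaltyMultiplier φ Φ xb yb L) :
    yb + ‖p.x - xb‖ ^ γ • p.scaledValue γ = p.y := by
  rw [scaledValue, smul_inv_smul₀ (Real.rpow_pos_of_pos p.norm_x_sub_pos _).ne', add_sub_cancel]

lemma add_smul_scaledValue_one (p : PenaltyMultiplier φ Φ xb yb L) :
    yb + ‖p.x - xb‖ • p.scaledValue 1 = p.y := by
  simpa only [Real.rpow_one] using p.add_smul_scaledValue 1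

lemma inner_scaledMultiplier_scaledValue_nonneg (γ : ℝ) (p : PenaltyMultiplier φ Φ xb yb L) :
    0 ≤ inner ℝ (p.scaledMultiplier γ) (p.scaledValue γ) := by
  rw [scaledMultiplier, scaledValue, real_inner_smul_left, real_inner_smul_right]
  have := p.inner_pos
  positivity

lemma norm_scaledMultiplier_mul_norm_scaledValue_le (γ : ℝ) (hfeas : xb ∈ invMap Φ yb)
    (p : PenaltyMultiplier φ Φ xb yb L) : ‖p.scaledMultiplier γ‖ * ‖p.scaledValue γ‖ ≤ 2 * L := by
  have ht := p.norm_x_sub_pos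
  have hpow : 0 < ‖p.x - xb‖ ^ (γ - 1) := Real.rpow_pos_of_pos ht _
  have hγ : ‖p.x - xb‖ ^ γ = ‖p.x - xb‖ ^ (γ - 1) * ‖p.x - xb‖ := by
    rw [← Real.rpow_add_one ht.ne', sub_add_cancel]
  calc ‖p.scaledMultiplier γ‖ * ‖p.scaledValue γ‖ = ‖p.lam‖ * ‖p.y - yb‖ / ‖p.x - xb‖ := by
        rw [scaledMultiplier, scaledValue, norm_smul_of_nonneg hpow.le,
          norm_smul_of_nonneg (by positivity), hγ]
        field_simp
    _ ≤ 2 * L * ‖p.x - xb‖ / ‖p.x - xb‖ := by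
        refine div_le_div_of_nonneg_right (p.norm_mul_le.trans ?_) ht.le
        gcongr
        exact (Metric.infDist_le_dist_of_mem hfeas).trans_eq (dist_eq_norm _ _)
    _ = 2 * L := mul_div_cancel_right₀ _ ht.ne'

lemma norm_scaledMultiplier_le_of_mul_infEDist_le {γ κ : ℝ} (hκ : 0 ≤ κ)
    (p : PenaltyMultiplier φ Φ xb yb L)
    (h : ENNReal.ofReal (‖p.x - xb‖ ^ (γ - 1)) * Metric.infEDist p.x (invMap Φ yb) ≤
      ENNReal.ofReal κ * Metric.infEDist yb (Φ p.x)) :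
    ‖p.scaledMultiplier γ‖ ≤ 2 * L * κ := by
  have hpow : 0 ≤ ‖p.x - xb‖ ^ (γ - 1) := by positivity
  have hmem : p.y ∈ Φ p.x := p.coderivative.1
  have hreal : ‖p.x - xb‖ ^ (γ - 1) * Metric.infDist p.x (invMap Φ yb) ≤ κ * ‖p.y - yb‖ := by
    have := ENNReal.toReal_mono (ENNReal.mul_ne_top ENNReal.ofReal_ne_top (edist_ne_top _ _))
      (h.trans (mul_le_mul_right (Metric.infEDist_le_edist_of_mem hmem) _))
    rwa [ENNReal.toReal_mul, ENNReal.toReal_mul, ENNReal.toReal_ofReal hpow,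
      ENNReal.toReal_ofReal hκ, ← dist_edist, dist_comm, dist_eq_norm] at this
  refine le_of_mul_le_mul_right ?_ (norm_pos_iff.2 p.y_sub_ne_zero)
  calc ‖p.scaledMultiplier γ‖ * ‖p.y - yb‖
      = ‖p.x - xb‖ ^ (γ - 1) * (‖p.lam‖ * ‖p.y - yb‖) := by
        rw [scaledMultiplier, norm_smul_of_nonneg hpow, mul_assoc]
    _ ≤ ‖p.x - xb‖ ^ (γ - 1) * (2 * L * Metric.infDist p.x (invMap Φ yb)) :=
        mul_le_mul_of_nonneg_left p.norm_mul_le hpow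
    _ = 2 * L * (‖p.x - xb‖ ^ (γ - 1) * Metric.infDist p.x (invMap Φ yb)) := by ring
    _ ≤ 2 * L * (κ * ‖p.y - yb‖) := by gcongr
    _ = 2 * L * κ * ‖p.y - yb‖ := by ring

/-- Convergence of penalty multipliers to the reference point along the direction `u`, with
subgradients converging to `ξ₀` and asymptotically exact multiplier rules. -/
structure ConvergesAlong (p : ℕ → PenaltyMultiplier φ Φ xb yb L) (u ξ₀ : X) : Prop where
  x : Tendsto (fun n => (p n).x) atTop (𝓝 xb)
  x' : Tendsto (fun n => (p n).x') atTop (𝓝 xb)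
  y : Tendsto (fun n => (p n).y) atTop (𝓝 yb)
  direction : Tendsto (fun n => normalize ((p n).x - xb)) atTop (𝓝 u)
  direction' : Tendsto (fun n => normalize ((p n).x' - xb)) atTop (𝓝 u)
  alignment :
    Tendsto (fun n => normalize ((p n).y - yb) - normalize (p n).lam) atTop (𝓝 0)
  subgradient : Tendsto (fun n => (p n).ξ) atTop (𝓝 ξ₀)
  coderivative : Tendsto (fun n => (p n).xs) atTop (𝓝 (-ξ₀))

variable {p : ℕ → PenaltyMultiplier φ Φ xb yb L} {u ξ₀ : X}

lemma exists_subseq_convergesAlong [FiniteDimensional ℝ X]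
    (hp : Tendsto (fun n => deviation xb yb (p n).toTuple) atTop (𝓝 0)) :
    ∃ u ξ₀, ∃ s : ℕ → ℕ, ConvergesAlong (p ∘ s) u ξ₀ := by
  have : ProperSpace X := FiniteDimensional.proper_real X
  obtain ⟨⟨ξ₀, u⟩, -, s, hs, hlim⟩ := tendsto_subseq_of_bounded
    (Metric.isBounded_closedBall (x := (0 : X × X)) (r := max L 1))
    (x := fun n => ((p n).ξ, normalize ((p n).x - xb))) (fun n => by
      rw [mem_closedBall_zero_iff, Prod.norm_def,
        NormedSpace.norm_normalize_eq_one_iff.2 (p n).x_sub_ne_zero]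
      exact max_le_max_right _ (p n).norm_subgradient_le)
  have hξ := hlim.fst_nhds
  have hu := hlim.snd_nhds
  have hdev := hp.comp hs.tendsto_atTop
  refine ⟨u, ξ₀, s, tendsto_sub_nhds_zero_iff.1 hdev.fst_nhds,
    tendsto_sub_nhds_zero_iff.1 hdev.snd_nhds.fst_nhds,
    tendsto_sub_nhds_zero_iff.1 hdev.snd_nhds.snd_nhds.fst_nhds, hu, ?_,
    hdev.snd_nhds.snd_nhds.snd_nhds.snd_nhds.snd_nhds, hξ, ?_⟩
  · have := hdev.snd_nhds.snd_nhds.snd_nhds.snd_nhds.fst_nhds.add hu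
    simpa [Function.comp_def, deviation, toTuple] using this
  · have := hdev.snd_nhds.snd_nhds.snd_nhds.fst_nhds.sub hξ
    simpa [Function.comp_def, deviation, toTuple] using this

namespace ConvergesAlong

lemma comp (h : ConvergesAlong p u ξ₀) {s : ℕ → ℕ} (hs : Tendsto s atTop atTop) :
    ConvergesAlong (p ∘ s) u ξ₀ where
  x := h.x.comp hs
  x' := h.x'.comp hs
  y := h.y.comp hs
  direction := h.direction.comp hs
  direction' := h.direction'.comp hs
  alignment := h.alignment.comp hs
  subgradient := h.subgradient.comp hs
  coderivative := h.coderivative.comp hs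

lemma posNull (h : ConvergesAlong p u ξ₀) : PosNull fun n => ‖(p n).x - xb‖ :=
  ⟨fun n => (p n).norm_x_sub_pos, tendsto_iff_norm_sub_tendsto_zero.1 h.x⟩

lemma norm_eq_one (h : ConvergesAlong p u ξ₀) : ‖u‖ = 1 :=
  tendsto_nhds_unique h.direction.norm (by
    simp only [NormedSpace.norm_normalize_eq_one_iff.2 (x_sub_ne_zero _), tendsto_const_nhds])

lemma eventually_mem_dirNhd (h : ConvergesAlong p u ξ₀) {ε δ : ℝ} (hε : 0 < ε) (hδ : 0 < δ) :
    ∀ᶠ n in atTop, (p n).x - xb ∈ dirNhd ε δ u := by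
  filter_upwards [h.posNull.2.eventually_lt_const hε,
    (tendsto_iff_norm_sub_tendsto_zero.1 h.direction).eventually_lt_const hδ] with n hnε hnδ
  refine ⟨?_, hnε.le⟩
  calc ‖‖(p n).x - xb‖ • u - ‖u‖ • ((p n).x - xb)‖
      = ‖normalize ((p n).x - xb) - u‖ * ‖(p n).x - xb‖ := by
        nth_rw 2 [← NormedSpace.norm_smul_normalize ((p n).x - xb)]
        rw [h.norm_eq_one, one_smul, ← smul_sub, norm_smul, norm_norm, mul_comm,
          norm_sub_rev u]
    _ ≤ δ * ‖u‖ * ‖(p n).x - xb‖ := by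
        rw [h.norm_eq_one, mul_one]
        gcongr

end ConvergesAlong

lemma tendsto_scaledValue_zero (hfeas : xb ∈ invMap Φ yb) {γ : ℝ}
    (h : Tendsto (fun n => ‖(p n).scaledMultiplier γ‖) atTop atTop) :
    Tendsto (fun n => (p n).scaledValue γ) atTop (𝓝 0) := by
  refine squeeze_zero_norm (fun n => ?_) (h.const_div_atTop (2 * L : ℝ))
  rw [le_div_iff₀' (norm_pos_iff.2 ((p n).scaledMultiplier_ne_zero γ))]
  exact (p n).norm_scaledMultiplier_mul_norm_scaledValue_le γ hfeas

lemma exists_tendsto_subseq_scaledValue [FiniteDimensional ℝ Y] (hfeas : xb ∈ invMap Φ yb) {γ : ℝ}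
    {l : Y} (hl : l ≠ 0) (h : Tendsto (fun n => (p n).scaledMultiplier γ) atTop (𝓝 l)) :
    ∃ v, ∃ s : ℕ → ℕ, StrictMono s ∧ Tendsto (fun n => (p (s n)).scaledValue γ) atTop (𝓝 v) := by
  have : ProperSpace Y := FiniteDimensional.proper_real Y
  refine exists_tendsto_subseq_of_not_tendsto_norm (z := fun n => (p n).scaledValue γ)
    fun hv => ?_
  obtain ⟨n, hn⟩ :=
    ((h.norm.pos_mul_atTop (norm_pos_iff.2 hl) hv).eventually_gt_atTop (2 * L : ℝ)).exists
  exact hn.not_ge ((p n).norm_scaledMultiplier_mul_norm_scaledValue_le γ hfeas)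

namespace ConvergesAlong

lemma isCriticalDirection (h : ConvergesAlong p u ξ₀) (hfeas : xb ∈ invMap Φ yb)
    (hlam : Tendsto (fun n => ‖(p n).lam‖) atTop atTop) : IsCriticalDirection φ Φ xb yb u := by
  refine ⟨mem_sphere_zero_iff_norm.2 h.norm_eq_one, _, _, _, h.direction,
    tendsto_scaledValue_zero (γ := 1) hfeas (by simpa only [scaledMultiplier_one] using hlam),
    h.posNull, fun n => ?_, ?_⟩
  · rw [add_smul_normalize, add_smul_scaledValue_one]
    exact (p n).coderivative.1
  · refine limsup_le_of_le (h := .of_forall fun n => ?_)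
    rw [add_smul_normalize, ← EReal.coe_zero, EReal.coe_le_coe_iff]
    exact div_nonpos_of_nonpos_of_nonneg (sub_nonpos.2 (p n).value_lt.le) (norm_nonneg _)

lemma mem_kerMap (h : ConvergesAlong p u ξ₀) (hfeas : xb ∈ invMap Φ yb)
    (hlam : Tendsto (fun n => ‖(p n).lam‖) atTop atTop) :
    u ∈ kerMap (graphicalDerivative Φ xb yb) := by
  refine ⟨hfeas, _, _, tendsto_pair h.direction (tendsto_scaledValue_zero (γ := 1) hfeas
    (by simpa only [scaledMultiplier_one] using hlam)), h.posNull, fun n => ?_⟩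
  rw [pair_add_smul, add_smul_normalize, add_smul_scaledValue_one]
  exact (p n).coderivative.1

lemma not_metricallyPseudoSubregular (h : ConvergesAlong p u ξ₀) {γ : ℝ}
    (hγ : Tendsto (fun n => ‖(p n).scaledMultiplier γ‖) atTop atTop) :
    ¬ MetricallyPseudoSubregular γ Φ xb yb u := by
  rintro ⟨ε, δ, κ, hε, hδ, hκ, hsub⟩
  obtain ⟨n, hn, hlt⟩ :=
    ((h.eventually_mem_dirNhd hε hδ).and (hγ.eventually_gt_atTop (2 * L * κ))).exists
  exact hlt.not_ge ((p n).norm_scaledMultiplier_le_of_mul_infEDist_le hκ.le (hsub _ hn))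

lemma mem_gfrererPseudoCoderivative (h : ConvergesAlong p u ξ₀) (hfeas : xb ∈ invMap Φ yb)
    (hlam : Tendsto (fun n => ‖(p n).lam‖) atTop atTop) {γ : ℝ}
    (hγ : Tendsto (fun n => (p n).scaledMultiplier γ) atTop (𝓝 0)) :
    -ξ₀ ∈ gfrererPseudoCoderivative γ Φ xb yb u 0 0 := by
  refine ⟨_, _, _, _, _, h.direction, tendsto_scaledValue_zero (γ := 1) hfeas
    (by simpa only [scaledMultiplier_one] using hlam), h.posNull, h.coderivative, hγ, fun n => ?_⟩
  rw [NormedSpace.norm_normalize_eq_one_iff.2 (p n).x_sub_ne_zero, mul_one, add_smul_normalize,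
    add_smul_scaledValue_one, inv_smul_scaledMultiplier]
  exact (p n).coderivative

lemma mem_pseudoCoderivative (h : ConvergesAlong p u ξ₀) {γ : ℝ} {v l : Y}
    (hv : Tendsto (fun n => (p n).scaledValue γ) atTop (𝓝 v))
    (hl : Tendsto (fun n => (p n).scaledMultiplier γ) atTop (𝓝 l)) :
    -ξ₀ ∈ pseudoCoderivative γ Φ xb yb u v l := by
  refine ⟨_, _, _, _, _, h.direction, hv, h.posNull, h.coderivative, hl, fun n => ?_⟩
  rw [NormedSpace.norm_normalize_eq_one_iff.2 (p n).x_sub_ne_zero, mul_one, add_smul_normalize,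
    add_smul_scaledValue, inv_smul_scaledMultiplier]
  exact (p n).coderivative

lemma isApproxStationaryAlong [FiniteDimensional ℝ Y] (h : ConvergesAlong p u ξ₀)
    (hfeas : xb ∈ invMap Φ yb) {γ : ℝ}
    (hγ : Tendsto (fun n => ‖(p n).scaledMultiplier γ‖) atTop atTop) :
    IsApproxStationaryAlong γ φ Φ xb yb u := by
  have : ProperSpace Y := FiniteDimensional.proper_real Y
  have hbound (n : ℕ) : ‖‖(p n).scaledValue γ‖ • (p n).scaledMultiplier γ‖ ≤ 2 * L := by
    rw [norm_smul, norm_norm, mul_comm]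
    exact (p n).norm_scaledMultiplier_mul_norm_scaledValue_le γ hfeas
  obtain ⟨yStar, -, s, hs, hys⟩ := tendsto_subseq_of_bounded
    (Metric.isBounded_closedBall (x := (0 : Y)) (r := 2 * L)) (fun n => by simpa using hbound n)
  replace h := h.comp hs.tendsto_atTop
  replace hγ := hγ.comp hs.tendsto_atTop
  have hpow (n : ℕ) : ‖(p (s n)).x - xb‖ ^ γ ≠ 0 :=
    (Real.rpow_pos_of_pos (p (s n)).norm_x_sub_pos _).ne'
  have hy (n : ℕ) : ‖(p (s n)).y - yb‖ ≠ 0 := norm_ne_zero_iff.2 (p (s n)).y_sub_ne_zero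
  have hvalue (n : ℕ) : ‖(p (s n)).scaledValue γ‖ =
      ‖(p (s n)).y - yb‖ / ‖(p (s n)).x - xb‖ ^ γ := by
    rw [scaledValue, norm_smul_of_nonneg (by positivity), inv_mul_eq_div]
  refine ⟨_, _, fun n => (p (s n)).ξ + (p (s n)).xs, _, _, _,
    fun n => (p (s n)).scaledMultiplier γ, yStar,
    fun n => ⟨(p (s n)).notMem, (p (s n)).notMem', sub_ne_zero.1 (p (s n)).y_sub_ne_zero, ?_⟩,
    fun n => rfl, fun n => ?_, h.x, h.x', h.y, h.direction, h.direction',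
    tendsto_scaledValue_zero hfeas hγ, hys, hγ, ?_, ?_, fun n => ?_⟩
  · simp only [Function.comp_apply, hvalue]
    exact smul_ne_zero (div_ne_zero (hy n) (hpow n)) ((p (s n)).scaledMultiplier_ne_zero γ)
  · simp only [Function.comp_apply, hvalue, smul_smul]
    rw [div_mul_div_cancel₀ (hy n), div_self (hpow n), one_smul]
  · simpa using h.subgradient.add h.coderivative
  · exact h.alignment.congr fun n => by
      rw [Function.comp_apply, ← normalize_scaledMultiplier γ]
      rfl
  · refine Set.add_mem_add (p (s n)).subgradient ?_
    simp only [inv_smul_scaledMultiplier]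
    exact (p (s n)).coderivative

lemma isMStationary_of_tendsto_lam [FiniteDimensional ℝ X] (h : ConvergesAlong p u ξ₀) {N : Set X}
    (hN : N ∈ 𝓝 xb) (hφ : LipschitzOnWith L φ N) (hfeas : xb ∈ invMap Φ yb) {l : Y}
    (hl : Tendsto (fun n => (p n).lam) atTop (𝓝 l)) : IsMStationary φ Φ xb yb := by
  have hη : Tendsto (fun n => (p n).ξ + (p n).xs) atTop (𝓝 0) := by
    simpa using h.subgradient.add h.coderivative
  exact isMStationary_of_mem_closure_fuzzyMultipliers hN hφ hfeas
    (mem_closure_of_tendsto (h.x.prodMk_nhds (h.x'.prodMk_nhds (h.y.prodMk_nhds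
      (hl.prodMk_nhds hη)))) (.of_forall fun n => (p n).toTuple_mem))

lemma isMStationary_or_isCriticalDirection_and [FiniteDimensional ℝ X] [FiniteDimensional ℝ Y]
    (h : ConvergesAlong p u ξ₀) {N : Set X} (hN : N ∈ 𝓝 xb) (hφ : LipschitzOnWith L φ N)
    (hfeas : xb ∈ invMap Φ yb) (γ : ℝ) :
    IsMStationary φ Φ xb yb ∨ IsCriticalDirection φ Φ xb yb u ∧
      (0 ∈ limitingSubdiff φ xb + gfrererPseudoCoderivative γ Φ xb yb u 0 0 ∨
      (∃ v lam : Y, lam ≠ 0 ∧ 0 ≤ inner ℝ lam v ∧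
        0 ∈ limitingSubdiff φ xb + pseudoCoderivative γ Φ xb yb u v lam) ∨
      (IsApproxStationaryAlong γ φ Φ xb yb u ∧
        u ∈ Metric.sphere (0 : X) 1 ∩ kerMap (graphicalDerivative Φ xb yb) ∧
        ¬ MetricallyPseudoSubregular γ Φ xb yb u)) := by
  have : ProperSpace Y := FiniteDimensional.proper_real Y
  by_cases hlam : Tendsto (fun n => ‖(p n).lam‖) atTop atTop
  swap
  · obtain ⟨l, s, hs, hl⟩ := exists_tendsto_subseq_of_not_tendsto_norm hlam
    exact .inl ((h.comp hs.tendsto_atTop).isMStationary_of_tendsto_lam hN hφ hfeas hl)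
  have hcrit := h.isCriticalDirection hfeas hlam
  have hξ₀ : ξ₀ ∈ limitingSubdiff φ xb := mem_limitingSubdiff_of_tendsto
    (hφ.continuousOn.continuousAt hN) h.x' h.subgradient fun n => (p n).subgradient
  refine .inr ⟨hcrit, ?_⟩
  by_cases hγ : Tendsto (fun n => ‖(p n).scaledMultiplier γ‖) atTop atTop
  · exact .inr (.inr ⟨h.isApproxStationaryAlong hfeas hγ, ⟨hcrit.1, h.mem_kerMap hfeas hlam⟩,
      h.not_metricallyPseudoSubregular hγ⟩)
  obtain ⟨l, s, hs, hl⟩ := exists_tendsto_subseq_of_not_tendsto_norm hγ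
  have hsub := h.comp hs.tendsto_atTop
  rcases eq_or_ne l 0 with rfl | hl₀
  · exact .inl ⟨ξ₀, hξ₀, -ξ₀, hsub.mem_gfrererPseudoCoderivative hfeas
      (hlam.comp hs.tendsto_atTop) hl, add_neg_cancel _⟩
  obtain ⟨v, r, hr, hv⟩ := exists_tendsto_subseq_scaledValue (p := p ∘ s) hfeas hl₀ hl
  have hl' := hl.comp hr.tendsto_atTop
  exact .inr (.inl ⟨v, l, hl₀,
    ge_of_tendsto' (hl'.inner hv) fun n => inner_scaledMultiplier_scaledValue_nonneg γ _,
    ξ₀, hξ₀, -ξ₀, (hsub.comp hr.tendsto_atTop).mem_pseudoCoderivative hv hl', add_neg_cancel _⟩)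

end ConvergesAlong

lemma isMStationary_or_exists_convergesAlong [FiniteDimensional ℝ X] [FiniteDimensional ℝ Y]
    {N : Set X} (hφ : LipschitzOnWith L φ N) (hN : N ∈ 𝓝 xb) (hΦ : IsClosed (gph Φ))
    (hfeas : xb ∈ invMap Φ yb) (hmin : IsLocalMinOn φ (invMap Φ yb) xb) :
    IsMStationary φ Φ xb yb ∨
      ∃ (p : ℕ → PenaltyMultiplier φ Φ xb yb L) (u ξ₀ : X), ConvergesAlong p u ξ₀ := by
  refine (isMStationary_or_zero_mem_closure hφ hN hΦ hfeas hmin).imp_right fun h => ?_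
  obtain ⟨z, hz, hlim⟩ := mem_closure_iff_seq_limit.1 h
  choose p hp using hz
  obtain rfl : (fun n => deviation xb yb (p n).toTuple) = z := funext hp
  obtain ⟨u, ξ₀, s, hs⟩ := exists_subseq_convergesAlong hlim
  exact ⟨p ∘ s, u, ξ₀, hs⟩

end PenaltyMultiplier

end PenaltyMultipliers

end VarAnalysis

theorem theorem4p3_general {X Y : Type*}
    [NormedAddCommGroup X] [InnerProductSpace ℝ X] [FiniteDimensional ℝ X]
    [NormedAddCommGroup Y] [InnerProductSpace ℝ Y] [FiniteDimensional ℝ Y]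
    {φ : X → ℝ} {L : ℝ≥0} {N : Set X} {Φ : X → Set Y} {xb : X} {yb : Y}
    (hN : N ∈ 𝓝 xb) (hφ : LipschitzOnWith L φ N) (hΦ : IsClosed (gph Φ))
    (hfeas : xb ∈ invMap Φ yb) (hmin : IsLocalMinOn φ (invMap Φ yb) xb) (γ : ℝ) :
    (IsMStationary φ Φ xb yb ∨
      (∃ u : X, IsCriticalDirection φ Φ xb yb u ∧
        0 ∈ limitingSubdiff φ xb + gfrererPseudoCoderivative γ Φ xb yb u 0 0) ∨
      (∃ (u : X) (v lam : Y), IsCriticalDirection φ Φ xb yb u ∧ lam ≠ 0 ∧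
        0 ≤ inner ℝ lam v ∧
        0 ∈ limitingSubdiff φ xb + pseudoCoderivative γ Φ xb yb u v lam) ∨
      (∃ u : X, IsCriticalDirection φ Φ xb yb u ∧
        IsApproxStationaryAlong γ φ Φ xb yb u)) ∧
    ((∀ u ∈ Metric.sphere (0 : X) 1 ∩ kerMap (graphicalDerivative Φ xb yb),
        MetricallyPseudoSubregular γ Φ xb yb u) →
      (IsMStationary φ Φ xb yb ∨
        (∃ u : X, IsCriticalDirection φ Φ xb yb u ∧
          0 ∈ limitingSubdiff φ xb + gfrererPseudoCoderivative γ Φ xb yb u 0 0) ∨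
        (∃ (u : X) (v lam : Y), IsCriticalDirection φ Φ xb yb u ∧ lam ≠ 0 ∧
          0 ≤ inner ℝ lam v ∧
          0 ∈ limitingSubdiff φ xb + pseudoCoderivative γ Φ xb yb u v lam))) := by
  rcases PenaltyMultiplier.isMStationary_or_exists_convergesAlong hφ hN hΦ hfeas hmin with
    hM | ⟨p, u, ξ₀, h⟩
  · exact ⟨.inl hM, fun _ => .inl hM⟩
  rcases h.isMStationary_or_isCriticalDirection_and hN hφ hfeas γ with
    hM | ⟨hu, hG | ⟨v, lam, hP⟩ | ⟨happrox, hker, hnot⟩⟩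
  · exact ⟨.inl hM, fun _ => .inl hM⟩
  · exact ⟨.inr (.inl ⟨u, hu, hG⟩), fun _ => .inr (.inl ⟨u, hu, hG⟩)⟩
  · exact ⟨.inr (.inr (.inl ⟨u, v, lam, hu, hP⟩)), fun _ => .inr (.inr ⟨u, v, lam, hu, hP⟩)⟩
  · exact ⟨.inr (.inr (.inr ⟨u, hu, happrox⟩)), fun hsub => absurd (hsub u hker) hnot⟩

theorem theorem4p3 {X Y : Type*}
    [NormedAddCommGroup X] [InnerProductSpace ℝ X] [FiniteDimensional ℝ X]
    [NormedAddCommGroup Y] [InnerProductSpace ℝ Y] [FiniteDimensional ℝ Y]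
    (φ : X → ℝ) (hφ : LocallyLipschitz φ)
    (Φ : X → Set Y) (hΦ : IsClosed (gph Φ))
    (xb : X) (yb : Y) (hfeas : xb ∈ invMap Φ yb)
    (hmin : IsLocalMinOn φ (invMap Φ yb) xb)
    (γ : ℝ) (hγ : 1 ≤ γ) :
    (IsMStationary φ Φ xb yb ∨
      (∃ u : X, IsCriticalDirection φ Φ xb yb u ∧
        0 ∈ limitingSubdiff φ xb + gfrererPseudoCoderivative γ Φ xb yb u 0 0) ∨
      (∃ (u : X) (v lam : Y), IsCriticalDirection φ Φ xb yb u ∧ lam ≠ 0 ∧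
        0 ≤ inner ℝ lam v ∧
        0 ∈ limitingSubdiff φ xb + pseudoCoderivative γ Φ xb yb u v lam) ∨
      (∃ u : X, IsCriticalDirection φ Φ xb yb u ∧
        IsApproxStationaryAlong γ φ Φ xb yb u)) ∧
    ((∀ u ∈ Metric.sphere (0 : X) 1 ∩ kerMap (graphicalDerivative Φ xb yb),
        MetricallyPseudoSubregular γ Φ xb yb u) →
      (IsMStationary φ Φ xb yb ∨
        (∃ u : X, IsCriticalDirection φ Φ xb yb u ∧
          0 ∈ limitingSubdiff φ xb + gfrererPseudoCoderivative γ Φ xb yb u 0 0) ∨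
        (∃ (u : X) (v lam : Y), IsCriticalDirection φ Φ xb yb u ∧ lam ≠ 0 ∧
          0 ≤ inner ℝ lam v ∧
          0 ∈ limitingSubdiff φ xb + pseudoCoderivative γ Φ xb yb u v lam))) := by
  obtain ⟨L, N, hN, hL⟩ := hφ xb
  exact theorem4p3_general hN hL hΦ hfeas hmin γ
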